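/- Let $X$ be a set, not necessarily finite, and let $r : X\times X\to X\times X$, $r(x,y)=({}^xy,x^y)$, be a non-degenerate symmetric set: $r^2=\mathrm{id}$, all maps $y\mapsto {}^xy$ and $x\mapsto x^y$ are bijective, and $r^{12}r^{23}r^{12}=r^{23}r^{12}r^{23}$ on $X\times X\times X$, where $r^{12}=r\times\mathrm{id}$ and $r^{23}=\mathrm{id}\times r$. Let $G=G(X,r)$ be the group generated by $X$ with the relations $xy=({}^xy)(x^y)$, $x,y\in X$. A braided group is a group $H$ with a bijective map $\sigma(a,u)=({}^au,a^u)$ of $H\times H$ onto itself such that, for all $a,b,u,v\in H$, ${}^a1=1$, ${}^1u=u$, $1^u=1$, $a^1=a$, ${}^{ab}u={}^a({}^bu)$, $a^{uv}=(a^u)^v$, ${}^a(uv)=({}^au)({}^{a^u}v)$, $(ab)^u=(a^{{}^bu})(b^u)$ and $uv=({}^uv)(u^v)$. Let $r_G : G\times G\to G\times G$ be the unique map that makes $(G,r_G)$ a braided group and satisfies $r_G\circ(i\times i)=(i\times i)\circ r$ for the canonical map $i : X\to G$; it exists and is involutive. Write again $r_G(a,b)=({}^ab,a^b)$. The operation $a+b:=a\,({}^{a^{-1}}b)$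 makes $(G,+,\cdot)$ a left brace, that is, $(G,+)$ is an abelian group and $a(b+c)+a=ab+ac$ for all $a,b,c\in G$; it is two-sided if also $(a+b)c+c=ac+bc$ for all $a,b,c\in G$. For a set $Y$, a map $s : Y\times Y\to Y\times Y$ is called square-free if $s(y,y)=(y,y)$ for all $y\in Y$, and the trivial solution if $s(y,z)=(z,y)$ for all $y,z\in Y$. Theorem. The following conditions are equivalent. (1) The left brace $(G,+,\cdot)$ is two-sided. (2) $(G,r_G)$ is square-free. (3) $(X,r)$ is square-free, and ${}^{xy}(xy)=xy$ for all $x,y\in G$. (4) The multiplicative group $G$ is free abelian on $X$: the canonical map $X\to G$ extends to an isomorphism from the free abelian group on $X$ onto $G$. (5) $(X,r)$ is the trivial solution. Moreover, if (4) holds then $(G,r_G)$ is the trivial solution. -/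

import Mathlib

namespace YangBaxter

universe u

/-! ### Quadratic sets and set-theoretic solutions of the Yang-Baxter equation -/

section Solutions

variable {X : Type u}

/-- The left action `ˣy`: the first component of `r (x, y)`. -/
def lact (r : X × X → X × X) (x y : X) : X := (r (x, y)).1

/-- The right action `xʸ`: the second component of `r (x, y)`. -/
def ract (r : X × X → X × X) (x y : X) : X := (r (x, y)).2

/-- `r × id` on `X × X × X`. -/
def r12 (r : X × X → X × X) (p : X × X × X) : X × X × X :=
  (lact r p.1 p.2.1, ract r p.1 p.2.1, p.2.2)

/-- `id × r` on `X × X × X`. -/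
def r23 (r : X × X → X × X) (p : X × X × X) : X × X × X :=
  (p.1, r p.2)

/-- All the maps `y ↦ ˣy` and `x ↦ xʸ` are bijective. -/
structure IsNondegenerate (r : X × X → X × X) : Prop where
  left : ∀ x, Function.Bijective fun y => lact r x y
  right : ∀ y, Function.Bijective fun x => ract r x y

/-- A non-degenerate symmetric set: `r` is an involutive (in particular bijective), non-degenerate
solution of the braid relation. -/
structure IsSymmetricSet (r : X × X → X × X) : Prop where
  involutive : Function.Involutive r
  braid : r12 r ∘ r23 r ∘ r12 r = r23 r ∘ r12 r ∘ r23 r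
  nondegenerate : IsNondegenerate r

/-- `r (x, x) = (x, x)` for all `x`. -/
def IsSquareFree (r : X × X → X × X) : Prop := ∀ x, r (x, x) = (x, x)

/-- The trivial solution: `r` is the flip. -/
def IsTrivialSolution (r : X × X → X × X) : Prop := ∀ x y, r (x, y) = (y, x)

end Solutions

/-! ### Braided groups, symmetric groups in the sense of Takeuchi, left braces -/

/-- A braided group `(G, σ)`: the triple `(G, G, σ)` is a matched pair of groups, and
`u v = (ᵘv)(uᵛ)` in `G`. -/
structure IsBraidedGroup {G : Type u} [Group G] (σ : G × G → G × G) : Prop where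
  bijective : Function.Bijective σ
  lact_one : ∀ a, lact σ a 1 = 1
  one_lact : ∀ v, lact σ 1 v = v
  one_ract : ∀ v, ract σ 1 v = 1
  ract_one : ∀ a, ract σ a 1 = a
  mul_lact : ∀ a b v, lact σ (a * b) v = lact σ a (lact σ b v)
  ract_mul : ∀ a v w, ract σ a (v * w) = ract σ (ract σ a v) w
  lact_mul : ∀ a v w, lact σ a (v * w) = lact σ a v * lact σ (ract σ a v) w
  mul_ract : ∀ a b v, ract σ (a * b) v = ract σ a (lact σ b v) * ract σ b v
  compat : ∀ v w, v * w = lact σ v w * ract σ v w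

/-- A symmetric group in the sense of Takeuchi: a braided group whose braiding operator is
involutive. -/
structure IsSymmetricGroup {G : Type u} [Group G] (σ : G × G → G × G) : Prop
    extends IsBraidedGroup σ where
  involutive : Function.Involutive σ

/-- A left brace `(G, +, ·)`. -/
class LeftBrace (G : Type u) extends Group G, AddCommGroup G where
  left_brace : ∀ a b c : G, a * (b + c) + a = a * b + a * c

/-- A left brace that is also a right brace. -/
def LeftBrace.IsTwoSided {G : Type u} (B : LeftBrace G) : Prop :=
  ∀ a b c : G, (a + b) * c + c = a * c + b * c

section BraceOfSymmetricGroup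

variable {G : Type u} [Group G] {σ : G × G → G × G}

/-- The sum `a + b = a (ᵃ⁻¹b)` on a symmetric group. -/
def braceAdd (σ : G × G → G × G) (a b : G) : G := a * lact σ a⁻¹ b

namespace IsSymmetricGroup

theorem lact_lact_ract (h : IsSymmetricGroup σ) (a b : G) :
    lact σ (lact σ a b) (ract σ a b) = a :=
  congrArg Prod.fst (h.involutive (a, b))

theorem lact_inv_lact (h : IsSymmetricGroup σ) (a b : G) : lact σ a⁻¹ (lact σ a b) = b := by
  rw [← h.mul_lact, inv_mul_cancel, h.one_lact]

theorem lact_lact_inv (h : IsSymmetricGroup σ) (a b : G) : lact σ a (lact σ a⁻¹ b) = b := by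
  rw [← h.mul_lact, mul_inv_cancel, h.one_lact]

theorem braceAdd_lact (h : IsSymmetricGroup σ) (a b : G) : braceAdd σ a (lact σ a b) = a * b := by
  rw [braceAdd, h.lact_inv_lact]

theorem braceAdd_comm (h : IsSymmetricGroup σ) (a b : G) : braceAdd σ a b = braceAdd σ b a := by
  have h1 := h.compat a (lact σ a⁻¹ b)
  have h2 := h.lact_lact_ract a (lact σ a⁻¹ b)
  rw [h.lact_lact_inv] at h1 h2
  rw [braceAdd, h1, braceAdd, ← h2, h.lact_inv_lact, h2]

theorem lact_braceAdd (h : IsSymmetricGroup σ) (a b c : G) :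
    lact σ a (braceAdd σ b c) = braceAdd σ (lact σ a b) (lact σ a c) := by
  obtain ⟨d, rfl⟩ : ∃ d, c = lact σ b d := ⟨_, (h.lact_lact_inv b c).symm⟩
  rw [h.braceAdd_lact, h.lact_mul, ← h.mul_lact a b, h.compat a b, h.mul_lact, h.braceAdd_lact]

theorem braceAdd_assoc (h : IsSymmetricGroup σ) (a b c : G) :
    braceAdd σ (braceAdd σ a b) c = braceAdd σ a (braceAdd σ b c) := by
  conv_rhs => rw [braceAdd, h.lact_braceAdd]
  simp only [braceAdd]
  rw [mul_inv_rev, h.mul_lact, mul_assoc]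

end IsSymmetricGroup

/-- The left brace associated to a symmetric group: the multiplication is the given one and
`a + b = a (ᵃ⁻¹b)`. -/
@[reducible] def IsSymmetricGroup.leftBrace (h : IsSymmetricGroup σ) : LeftBrace G where
  toGroup := ‹Group G›
  add := braceAdd σ
  zero := 1
  neg a := lact σ a a⁻¹
  nsmul := @nsmulRec G ⟨(1 : G)⟩ ⟨braceAdd σ⟩
  zsmul := @zsmulRec G ⟨(1 : G)⟩ ⟨braceAdd σ⟩ ⟨fun a => lact σ a a⁻¹⟩
    (@nsmulRec G ⟨(1 : G)⟩ ⟨braceAdd σ⟩)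
  add_assoc := h.braceAdd_assoc
  zero_add a := by
    change braceAdd σ 1 a = a
    rw [braceAdd, inv_one, h.one_lact, one_mul]
  add_zero a := by
    change braceAdd σ a 1 = a
    rw [braceAdd, h.lact_one, mul_one]
  neg_add_cancel a := by
    change braceAdd σ (lact σ a a⁻¹) a = 1
    rw [h.braceAdd_comm, h.braceAdd_lact, mul_inv_cancel]
  add_comm := h.braceAdd_comm
  left_brace a b c := by
    change braceAdd σ (a * braceAdd σ b c) a = braceAdd σ (a * b) (a * c)
    rw [← h.braceAdd_lact a, ← h.braceAdd_lact a b, ← h.braceAdd_lact a c, h.lact_braceAdd,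
      h.braceAdd_assoc, h.braceAdd_assoc, h.braceAdd_assoc, h.braceAdd_comm a (lact σ a c)]

end BraceOfSymmetricGroup

/-! ### The Yang-Baxter group of a quadratic set -/

section YBGroup

variable {X : Type u}

/-- The relations `x y = (ˣy)(xʸ)`, written as words. -/
def ybRels (r : X × X → X × X) : Set (FreeGroup X) :=
  {w | ∃ x y, w = FreeGroup.of x * FreeGroup.of y *
    (FreeGroup.of (lact r x y) * FreeGroup.of (ract r x y))⁻¹}

/-- The group `G(X, r)` generated by `X` with the relations `x y = (ˣy)(xʸ)`. -/
abbrev YBGroup (r : X × X → X × X) : Type u := PresentedGroup (ybRels r)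

/-- The canonical map `X → G(X, r)`. -/
def ybOf (r : X × X → X × X) (x : X) : YBGroup r := PresentedGroup.of x

/-- `G(X, r)` is free abelian on `X`: the canonical map `X → G(X, r)` extends to an isomorphism
from the free abelian group on `X`. -/
def YBGroup.IsFreeAbelian (r : X × X → X × X) : Prop :=
  ∃ e : FreeAbelianGroup X ≃+ Additive (YBGroup r),
    ∀ x, e (FreeAbelianGroup.of x) = Additive.ofMul (ybOf r x)

/-- The map `σ` on `G(X, r) × G(X, r)` extends `r` along the canonical map `X → G(X, r)`. -/
def Extends (r : X × X → X × X) (σ : YBGroup r × YBGroup r → YBGroup r × YBGroup r) : Prop :=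
  σ ∘ Prod.map (ybOf r) (ybOf r) = Prod.map (ybOf r) (ybOf r) ∘ r

variable {r : X × X → X × X}

theorem ybOf_mul (x y : X) :
    ybOf r x * ybOf r y = ybOf r (lact r x y) * ybOf r (ract r x y) := by
  have h : PresentedGroup.mk (ybRels r) (FreeGroup.of x * FreeGroup.of y *
      (FreeGroup.of (lact r x y) * FreeGroup.of (ract r x y))⁻¹) = 1 :=
    PresentedGroup.one_of_mem ⟨x, y, rfl⟩
  rw [map_mul, map_inv, mul_inv_eq_one, map_mul, map_mul] at h
  exact h

theorem YBGroup.induction {C : YBGroup r → Prop} (one : C 1) (of : ∀ x, C (ybOf r x))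
    (inv_of : ∀ x, C (ybOf r x)⁻¹) (mul : ∀ a b, C a → C b → C (a * b)) (a : YBGroup r) : C a := by
  induction a using PresentedGroup.induction_on with
  | _ z =>
    induction z using FreeGroup.induction_on with
    | C1 => simpa using one
    | of x => exact of x
    | inv_of x _ => exact inv_of x
    | mul a b ha hb => simpa using mul _ _ ha hb

/-! ### The braiding operator on the Yang-Baxter group: uniqueness -/

namespace Extends

theorem lact_of {σ : YBGroup r × YBGroup r → YBGroup r × YBGroup r} (h : Extends r σ) (x y : X) :
    lact σ (ybOf r x) (ybOf r y) = ybOf r (lact r x y) :=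
  congrArg Prod.fst (congrFun h (x, y))

theorem ract_of {σ : YBGroup r × YBGroup r → YBGroup r × YBGroup r} (h : Extends r σ) (x y : X) :
    ract σ (ybOf r x) (ybOf r y) = ybOf r (ract r x y) :=
  congrArg Prod.snd (congrFun h (x, y))

end Extends

theorem IsBraidedGroup.eq_of_extends (hr : IsNondegenerate r)
    {σ τ : YBGroup r × YBGroup r → YBGroup r × YBGroup r} (hσ : IsBraidedGroup σ)
    (hτ : IsBraidedGroup τ) (eσ : Extends r σ) (eτ : Extends r τ) : σ = τ := by
  have P : ∀ u : YBGroup r, ∀ x, lact σ (ybOf r x) u = lact τ (ybOf r x) u ∧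
      ∃ z, ract σ (ybOf r x) u = ybOf r z ∧ ract τ (ybOf r x) u = ybOf r z := by
    intro u
    induction u using YBGroup.induction with
    | one => exact fun x => ⟨by rw [hσ.lact_one, hτ.lact_one], x, hσ.ract_one _, hτ.ract_one _⟩
    | of y => exact fun x => ⟨by rw [eσ.lact_of, eτ.lact_of], _, eσ.ract_of x y, eτ.ract_of x y⟩
    | inv_of y =>
      intro x
      obtain ⟨z, rfl⟩ := (hr.right y).2 x
      have key : ∀ {ρ : YBGroup r × YBGroup r → YBGroup r × YBGroup r}, IsBraidedGroup ρ →
          Extends r ρ → lact ρ (ybOf r (ract r z y)) (ybOf r y)⁻¹ = (ybOf r (lact r z y))⁻¹ ∧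
            ract ρ (ybOf r (ract r z y)) (ybOf r y)⁻¹ = ybOf r z := by
        intro ρ hρ eρ
        rw [← eρ.ract_of, ← eρ.lact_of]
        constructor
        · rw [eq_inv_iff_mul_eq_one, mul_eq_one_comm, ← hρ.lact_mul, mul_inv_cancel, hρ.lact_one]
        · rw [← hρ.ract_mul, mul_inv_cancel, hρ.ract_one]
      exact ⟨(key hσ eσ).1.trans (key hτ eτ).1.symm, z, (key hσ eσ).2, (key hτ eτ).2⟩
    | mul u v hu hv =>
      intro x
      obtain ⟨h1, z, h2, h3⟩ := hu x
      obtain ⟨k1, w, k2, k3⟩ := hv z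
      exact ⟨by rw [hσ.lact_mul, hτ.lact_mul, h2, h3, h1, k1], w,
        by rw [hσ.ract_mul, h2, k2], by rw [hτ.ract_mul, h3, k3]⟩
  have Q : ∀ a u : YBGroup r, lact σ a u = lact τ a u := by
    intro a
    induction a using YBGroup.induction with
    | one => exact fun u => by rw [hσ.one_lact, hτ.one_lact]
    | of x => exact fun u => (P u x).1
    | inv_of x =>
      intro u
      have h1 : lact τ (ybOf r x) (lact τ (ybOf r x)⁻¹ u) = u := by
        rw [← hτ.mul_lact, mul_inv_cancel, hτ.one_lact]
      conv_lhs => rw [← h1, ← (P _ x).1, ← hσ.mul_lact, inv_mul_cancel, hσ.one_lact]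
    | mul a b ha hb => exact fun u => by rw [hσ.mul_lact, hτ.mul_lact, hb, ha]
  funext p
  obtain ⟨a, b⟩ := p
  refine Prod.ext (Q a b) ?_
  have h1 := hσ.compat a b
  rw [hτ.compat a b, Q a b] at h1
  exact (mul_left_cancel h1).symm

end YBGroup

/-! ### The braiding operator on the Yang-Baxter group: existence

`G(X, r)` acts on `X` through `ybPerm`, and `cocycle : G(X, r) → ℤ^(X)`, determined by `x ↦ e_x` and
`cocycle (a b) = cocycle a + ᵃ(cocycle b)`, is a bijection; the left action of `G(X, r)` on `ℤ^(X)`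
is transported along it to a left action of `G(X, r)` on itself. -/

namespace IsSymmetricSet

variable {X : Type u} {r : X × X → X × X}

theorem lact_lact (h : IsSymmetricSet r) (x y z : X) :
    lact r (lact r x y) (lact r (ract r x y) z) = lact r x (lact r y z) :=
  congrArg (fun p : X × X × X => p.1) (congrFun h.braid (x, y, z))

theorem lact_lact_ract (h : IsSymmetricSet r) (x y : X) :
    lact r (lact r x y) (ract r x y) = x :=
  congrArg Prod.fst (h.involutive (x, y))

theorem ract_lact_ract (h : IsSymmetricSet r) (x y : X) :
    ract r (lact r x y) (ract r x y) = y :=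
  congrArg Prod.snd (h.involutive (x, y))

/-- The canonical left action of `G(X, r)` on `X`. -/
noncomputable def ybPerm (h : IsSymmetricSet r) : YBGroup r →* Equiv.Perm X :=
  PresentedGroup.toGroup (f := fun x => Equiv.ofBijective _ (h.nondegenerate.left x)) <| by
    rintro _ ⟨x, y, rfl⟩
    ext z
    simp only [map_mul, map_inv, FreeGroup.lift_apply_of]
    rw [mul_inv_eq_one.mpr]
    ext z
    exact (h.lact_lact x y z).symm

theorem ybPerm_of (h : IsSymmetricSet r) (x y : X) : h.ybPerm (ybOf r x) y = lact r x y := by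
  rw [ybPerm, ybOf, PresentedGroup.toGroup.of]
  rfl

/-- The induced action of `G(X, r)` on the free abelian group `ℤ^(X)`. -/
noncomputable def linAct (h : IsSymmetricSet r) (a : YBGroup r) : (X →₀ ℤ) ≃+ (X →₀ ℤ) :=
  Finsupp.domCongr (h.ybPerm a)

theorem linAct_single (h : IsSymmetricSet r) (a : YBGroup r) (x : X) (n : ℤ) :
    h.linAct a (Finsupp.single x n) = Finsupp.single (h.ybPerm a x) n := by
  simp [linAct]

theorem linAct_mul (h : IsSymmetricSet r) (a b : YBGroup r) (v : X →₀ ℤ) :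
    h.linAct (a * b) v = h.linAct a (h.linAct b v) := by
  ext x
  simp only [linAct, map_mul, Finsupp.domCongr_apply, Finsupp.equivMapDomain_apply]
  rfl

theorem linAct_one (h : IsSymmetricSet r) (v : X →₀ ℤ) : h.linAct 1 v = v := by
  ext x
  simp only [linAct, map_one, Finsupp.domCongr_apply, Finsupp.equivMapDomain_apply]
  rfl

/-- The affine action of `G(X, r)` on `ℤ^(X)`, in which `x` acts as `v ↦ e_x + ˣv`. -/
noncomputable def affine (h : IsSymmetricSet r) : YBGroup r →* Equiv.Perm (X →₀ ℤ) :=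
  PresentedGroup.toGroup (f := fun x => (h.linAct (ybOf r x)).toEquiv.trans
      (Equiv.addLeft (Finsupp.single x 1))) <| by
    rintro _ ⟨x, y, rfl⟩
    simp only [map_mul, map_inv, FreeGroup.lift_apply_of]
    rw [mul_inv_eq_one.mpr]
    ext1 v
    simp only [Equiv.Perm.mul_apply, Equiv.trans_apply, Equiv.coe_addLeft, map_add, linAct_single, ybPerm_of, h.lact_lact_ract, ← linAct_mul, ybOf_mul x y,
      AddEquiv.toEquiv_eq_coe, EquivLike.coe_coe]
    abel

theorem affine_of (h : IsSymmetricSet r) (x : X) (v : X →₀ ℤ) :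
    h.affine (ybOf r x) v = Finsupp.single x 1 + h.linAct (ybOf r x) v := by
  rw [affine, ybOf, PresentedGroup.toGroup.of]
  rfl

/-- The canonical bijective 1-cocycle `G(X, r) → ℤ^(X)`. -/
noncomputable def cocycle (h : IsSymmetricSet r) (a : YBGroup r) : X →₀ ℤ := h.affine a 0

theorem affine_apply (h : IsSymmetricSet r) (a : YBGroup r) (v : X →₀ ℤ) :
    h.affine a v = h.cocycle a + h.linAct a v := by
  unfold cocycle
  induction a using YBGroup.induction generalizing v with
  | one => simp [linAct_one]
  | of x => simp [affine_of]
  | inv_of x =>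
    rw [map_inv, Equiv.Perm.inv_eq_iff_eq, affine_of, map_add, ← linAct_mul, mul_inv_cancel,
      linAct_one, ← add_assoc, ← affine_of, ← Equiv.Perm.mul_apply, mul_inv_cancel,
      Equiv.Perm.one_apply, zero_add]
  | mul a b ha hb =>
    rw [map_mul, Equiv.Perm.mul_apply, Equiv.Perm.mul_apply, ha, hb, ha (h.affine b 0), map_add,
      linAct_mul, add_assoc]

theorem cocycle_mul (h : IsSymmetricSet r) (a b : YBGroup r) :
    h.cocycle (a * b) = h.cocycle a + h.linAct a (h.cocycle b) := by
  rw [← affine_apply, cocycle, map_mul, Equiv.Perm.mul_apply, cocycle]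

theorem cocycle_one (h : IsSymmetricSet r) : h.cocycle 1 = 0 := by
  simp [cocycle]

theorem cocycle_of (h : IsSymmetricSet r) (x : X) : h.cocycle (ybOf r x) = Finsupp.single x 1 := by
  simp [cocycle, affine_of]

theorem ybPerm_ract (h : IsSymmetricSet r) (z y : X) (hz : h.ybPerm (ybOf r z) y = z) :
    ract r z y = y := by
  rw [ybPerm_of] at hz
  have h1 := h.lact_lact_ract z y
  rw [hz] at h1
  exact (h.nondegenerate.left z).1 (h1.trans hz.symm)

theorem ybPerm_of_ract (h : IsSymmetricSet r) (z y : X) (hz : ract r z y = y) :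
    h.ybPerm (ybOf r z) y = z := by
  rw [ybPerm_of]
  have h1 := h.ract_lact_ract z y
  rw [hz] at h1
  exact (h.nondegenerate.right y).1 (h1.trans hz.symm)

/-- The translation `g ↦ g + x` of `G(X, r)` as a map, `g ↦ g (ᵍ⁻¹x)`. -/
noncomputable def translate (h : IsSymmetricSet r) (x : X) (g : YBGroup r) : YBGroup r :=
  g * ybOf r (h.ybPerm g⁻¹ x)

theorem ybPerm_translate_inv (h : IsSymmetricSet r) (x y : X) (g : YBGroup r) :
    h.ybPerm (h.translate x g)⁻¹ y =
      (h.ybPerm (ybOf r (h.ybPerm g⁻¹ x)))⁻¹ (h.ybPerm g⁻¹ y) := by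
  rw [translate, mul_inv_rev, map_mul, Equiv.Perm.mul_apply, map_inv]

theorem translate_bijective (h : IsSymmetricSet r) (x : X) :
    Function.Bijective (h.translate x) := by
  have key : ∀ g, ract r (h.ybPerm g⁻¹ x) (h.ybPerm (h.translate x g)⁻¹ x) =
      h.ybPerm (h.translate x g)⁻¹ x := by
    intro g
    apply h.ybPerm_ract
    rw [ybPerm_translate_inv, ← Equiv.Perm.mul_apply, mul_inv_cancel, Equiv.Perm.one_apply]

  constructor
  · intro g g' hg
    have h1 := key g
    have h2 := key g'
    rw [← hg] at h2
    have h3 : h.ybPerm g⁻¹ x = h.ybPerm g'⁻¹ x :=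
      (h.nondegenerate.right (h.ybPerm (h.translate x g)⁻¹ x)).1 (h1.trans h2.symm)
    rw [translate, translate, h3] at hg
    exact mul_right_cancel hg
  · intro k
    obtain ⟨z, hz⟩ := (h.nondegenerate.right (h.ybPerm k⁻¹ x)).2 (h.ybPerm k⁻¹ x)
    refine ⟨k * (ybOf r z)⁻¹, ?_⟩
    have h1 : h.ybPerm (k * (ybOf r z)⁻¹)⁻¹ x = z := by
      rw [mul_inv_rev, inv_inv, map_mul, Equiv.Perm.mul_apply]
      exact h.ybPerm_of_ract _ _ hz
    rw [translate, h1, inv_mul_cancel_right]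

theorem translate_comm (h : IsSymmetricSet r) (x y : X) (g : YBGroup r) :
    h.translate y (h.translate x g) = h.translate x (h.translate y g) := by
  have key : ∀ u v : X, ybOf r u * ybOf r ((h.ybPerm (ybOf r u))⁻¹ v) =
      ybOf r v * ybOf r ((h.ybPerm (ybOf r v))⁻¹ u) := by
    intro u v
    obtain ⟨w, rfl⟩ := (h.nondegenerate.left u).2 v
    have h1 : (h.ybPerm (ybOf r u))⁻¹ (lact r u w) = w := by
      rw [Equiv.Perm.inv_eq_iff_eq, ybPerm_of]
    have h2 : (h.ybPerm (ybOf r (lact r u w)))⁻¹ u = ract r u w := by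
      rw [Equiv.Perm.inv_eq_iff_eq, ybPerm_of, h.lact_lact_ract]
    change ybOf r u * ybOf r ((h.ybPerm (ybOf r u))⁻¹ (lact r u w)) =
      ybOf r (lact r u w) * ybOf r ((h.ybPerm (ybOf r (lact r u w)))⁻¹ u)
    rw [h1, h2, ybOf_mul]
  rw [translate, ybPerm_translate_inv, translate, mul_assoc, key, ← mul_assoc, translate,
    ybPerm_translate_inv, translate]

theorem cocycle_translate (h : IsSymmetricSet r) (x : X) (g : YBGroup r) :
    h.cocycle (h.translate x g) = h.cocycle g + Finsupp.single x 1 := by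
  rw [translate, cocycle_mul, cocycle_of, linAct_single, ← Equiv.Perm.mul_apply, ← map_mul,
    mul_inv_cancel, map_one, Equiv.Perm.one_apply]

theorem cocycle_surjective (h : IsSymmetricSet r) : Function.Surjective h.cocycle := by
  have step : ∀ (x : X) (n : ℤ) (v : X →₀ ℤ), (∃ a, h.cocycle a = v) →
      ∃ a, h.cocycle a = v + Finsupp.single x n := by
    intro x n v hv
    induction n using Int.induction_on with
    | zero => simpa using hv
    | succ n ih =>
      obtain ⟨a, ha⟩ := ih
      exact ⟨h.translate x a, by rw [cocycle_translate, ha, Finsupp.single_add, add_assoc]⟩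
    | pred n ih =>
      obtain ⟨a, ha⟩ := ih
      obtain ⟨b, rfl⟩ := (h.translate_bijective x).2 a
      rw [cocycle_translate] at ha
      exact ⟨b, by rw [Finsupp.single_sub, ← add_sub_assoc, ← ha, add_sub_cancel_right]⟩
  intro v
  induction v using Finsupp.induction with
  | zero => exact ⟨1, h.cocycle_one⟩
  | single_add x n v _ _ ih =>
    rw [add_comm]
    exact step x n v ih

/-- The group generated by the translations. -/
noncomputable def translations (h : IsSymmetricSet r) : Subgroup (Equiv.Perm (YBGroup r)) :=
  Subgroup.closure (Set.range fun x => Equiv.ofBijective _ (h.translate_bijective x))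

theorem exists_section (h : IsSymmetricSet r) :
    ∃ s : (X →₀ ℤ) → YBGroup r, ∀ a, s (h.cocycle a) = a := by
  have hc : ∀ f ∈ Set.range (fun x => Equiv.ofBijective _ (h.translate_bijective x)),
      ∀ g ∈ Set.range (fun x => Equiv.ofBijective _ (h.translate_bijective x)),
      f * g = g * f := by
    rintro _ ⟨x, rfl⟩ _ ⟨y, rfl⟩
    ext1 g
    exact h.translate_comm y x g
  have : IsMulCommutative h.translations := Subgroup.isMulCommutative_closure hc
  let _ : CommGroup h.translations :=
    { (inferInstance : Group h.translations) with mul_comm := this.is_comm.comm }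
  let t : X → Additive h.translations := fun x =>
    Additive.ofMul ⟨_, Subgroup.subset_closure (Set.mem_range_self x)⟩
  let F : (X →₀ ℤ) →+ Additive h.translations :=
    Finsupp.liftAddHom fun x => (zmultiplesHom _ (t x))
  let S : (X →₀ ℤ) → Equiv.Perm (YBGroup r) := fun v => ((F v).toMul : h.translations).1
  have S_add : ∀ x v g, S (v + Finsupp.single x 1) g = h.translate x (S v g) := by
    intro x v g
    have h1 : F (v + Finsupp.single x 1) = t x + F v := by
      rw [add_comm, map_add]
      exact congrArg (· + F v) ((Finsupp.liftAddHom_apply_single _ _ _).trans (one_zsmul _))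
    change ((F (v + Finsupp.single x 1)).toMul : h.translations).1 g = _
    rw [h1]
    rfl
  have S_zero : ∀ g, S 0 g = g := by
    intro g
    change ((F 0).toMul : h.translations).1 g = g
    rw [map_zero]
    rfl
  have tr : ∀ (x : X) (a : YBGroup r), h.translate (h.ybPerm a x) a = a * ybOf r x := by
    intro x a
    rw [translate, ← Equiv.Perm.mul_apply, ← map_mul, inv_mul_cancel, map_one,
      Equiv.Perm.one_apply]
  have main : ∀ b a : YBGroup r, S (h.cocycle a) 1 = a ↔ S (h.cocycle (a * b)) 1 = a * b := by
    intro b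
    induction b using YBGroup.induction with
    | one => simp
    | of x =>
      intro a
      rw [← tr, cocycle_translate, S_add]
      exact (h.translate_bijective _).1.eq_iff.symm
    | inv_of x =>
      intro a
      obtain ⟨b, rfl⟩ : ∃ b, a = b * ybOf r x := ⟨a * (ybOf r x)⁻¹, by simp⟩
      rw [mul_inv_cancel_right, ← tr, cocycle_translate, S_add]
      exact (h.translate_bijective _).1.eq_iff
    | mul b c hb hc => exact fun a => by rw [hb a, hc (a * b), mul_assoc]
  refine ⟨fun v => S v 1, fun a => ?_⟩
  have h1 := (main a 1).1 (by rw [cocycle_one, S_zero])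
  rwa [one_mul] at h1

theorem cocycle_bijective (h : IsSymmetricSet r) : Function.Bijective h.cocycle :=
  ⟨Function.LeftInverse.injective h.exists_section.choose_spec, h.cocycle_surjective⟩

/-- The left action of `G(X, r)` on itself, transported from `ℤ^(X)`. -/
noncomputable def act (h : IsSymmetricSet r) (a b : YBGroup r) : YBGroup r :=
  (Equiv.ofBijective _ h.cocycle_bijective).symm (h.linAct a (h.cocycle b))

theorem cocycle_act (h : IsSymmetricSet r) (a b : YBGroup r) :
    h.cocycle (h.act a b) = h.linAct a (h.cocycle b) :=
  (Equiv.ofBijective _ h.cocycle_bijective).apply_symm_apply _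

theorem exists_isSymmetricGroup (h : IsSymmetricSet r) :
    ∃ σ : YBGroup r × YBGroup r → YBGroup r × YBGroup r, IsSymmetricGroup σ ∧ Extends r σ := by
  have inj := h.cocycle_bijective.1
  have act_one : ∀ a, h.act a 1 = 1 := fun a => inj <| by
    rw [cocycle_act, cocycle_one, map_zero]
  have one_act : ∀ a, h.act 1 a = a := fun a => inj <| by rw [cocycle_act, linAct_one]
  have mul_act : ∀ a b c, h.act (a * b) c = h.act a (h.act b c) := fun a b c => inj <| by
    simp only [cocycle_act, linAct_mul]
  have act_mul : ∀ a b c, h.act a (b * c) = h.act a b * h.act ((h.act a b)⁻¹ * a * b) c :=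
    fun a b c => inj <| by
      simp only [cocycle_act, cocycle_mul, map_add, ← linAct_mul]
      congr 3
      group
  have act_act : ∀ a b, h.act (h.act a b) ((h.act a b)⁻¹ * a * b) = a := fun a b => inj <| by
    have h1 := h.cocycle_mul (h.act a b) ((h.act a b)⁻¹ * a * b)
    rw [mul_assoc, mul_inv_cancel_left, cocycle_mul, cocycle_act, add_comm] at h1
    rw [cocycle_act, mul_assoc]
    exact (add_left_cancel h1).symm
  have inv : Function.Involutive fun p : YBGroup r × YBGroup r =>
      (h.act p.1 p.2, (h.act p.1 p.2)⁻¹ * p.1 * p.2) := by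
    rintro ⟨a, b⟩
    refine Prod.ext (act_act a b) ?_
    simp only [act_act]
    group
  refine ⟨fun p => (h.act p.1 p.2, (h.act p.1 p.2)⁻¹ * p.1 * p.2),
    { bijective := inv.bijective, lact_one := act_one, one_lact := one_act,
      one_ract := fun v => ?_, ract_one := fun a => ?_, mul_lact := mul_act,
      ract_mul := fun a v w => ?_, lact_mul := act_mul, mul_ract := fun a b v => ?_,
      compat := fun v w => ?_, involutive := inv }, ?_⟩
  · simp [ract, one_act]
  · simp [ract, act_one]
  · simp only [ract, act_mul]
    group
  · simp only [ract, lact, mul_act]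
    group
  · simp only [ract, lact]
    group
  · funext p
    obtain ⟨x, y⟩ := p
    have h1 : h.act (ybOf r x) (ybOf r y) = ybOf r (lact r x y) := inj <| by
      rw [cocycle_act, cocycle_of, cocycle_of, linAct_single, ybPerm_of]
    refine Prod.ext h1 ?_
    change (h.act (ybOf r x) (ybOf r y))⁻¹ * ybOf r x * ybOf r y = ybOf r (ract r x y)
    rw [h1, mul_assoc, ybOf_mul, inv_mul_cancel_left]

/-- There is a unique braiding operator on `G(X, r)` that extends `r`. -/
theorem existsUnique_braiding (h : IsSymmetricSet r) :
    ∃! σ : YBGroup r × YBGroup r → YBGroup r × YBGroup r, IsBraidedGroup σ ∧ Extends r σ := by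
  obtain ⟨σ, hσ, eσ⟩ := h.exists_isSymmetricGroup
  exact ⟨σ, ⟨hσ.toIsBraidedGroup, eσ⟩, fun τ hτ =>
    IsBraidedGroup.eq_of_extends h.nondegenerate hτ.1 hσ.toIsBraidedGroup hτ.2 eσ⟩

/-- The braiding operator `r_G` of the symmetric group `(G, r_G)` associated to `(X, r)`, where
`G = G(X, r)`: the unique braiding operator on `G` that extends `r`. -/
noncomputable def braiding (h : IsSymmetricSet r) : YBGroup r × YBGroup r → YBGroup r × YBGroup r :=
  h.existsUnique_braiding.choose

theorem braiding_extends (h : IsSymmetricSet r) : Extends r h.braiding :=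
  h.existsUnique_braiding.choose_spec.1.2

theorem braiding_isSymmetricGroup (h : IsSymmetricSet r) : IsSymmetricGroup h.braiding := by
  obtain ⟨σ, hσ, eσ⟩ := h.exists_isSymmetricGroup
  have h1 := h.existsUnique_braiding.choose_spec.2 σ ⟨hσ.toIsBraidedGroup, eσ⟩
  rw [braiding, ← h1]
  exact hσ

/-- The left brace `(G, +, ·)` associated to the solution `(X, r)`. -/
@[reducible] noncomputable def leftBrace (h : IsSymmetricSet r) : LeftBrace (YBGroup r) :=
  h.braiding_isSymmetricGroup.leftBrace

end IsSymmetricSet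

end YangBaxter

namespace YangBaxter

namespace IsSymmetricSet

variable {X : Type*} {r : X × X → X × X}

/-! The bijective cocycle `h.cocycle : G → ℤ^(X)`, written π here, satisfies π(ab) = π(a) + a·π(b),
where G permutes the basis vectors e_x. By `cocycle_lact_braiding` it carries the left action of
`h.braiding` to this permutation action, and by `cocycle_braceAdd` it carries the brace sum to
vector addition. Every condition thus becomes an identity between vectors of ℤ^(X).

If the solution is trivial, then G acts trivially, π is an isomorphism onto ℤ^(X), and product and
sum coincide; all the other conditions follow. Conversely, each condition is applied to a short word
in generators and read at one coordinate, where a basis vector contributes only 0 or 1. The count is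
impossible unless ˣy = y, and involutivity then makes `r` the flip. Finiteness of X plays no role.
-/

theorem single_one_apply_mem (x y : X) :
    Finsupp.single x (1 : ℤ) y = 0 ∨ Finsupp.single x (1 : ℤ) y = 1 := by
  classical
  rw [Finsupp.single_apply]
  split_ifs <;> simp

theorem isTrivialSolution_of_lact_eq (h : IsSymmetricSet r) (hl : ∀ x y, lact r x y = y) :
    IsTrivialSolution r := by
  intro x y
  have h1 := h.lact_lact_ract x y
  rw [hl] at h1
  exact Prod.ext (hl x y) h1

/-! ### The brace operations seen through the cocycle. -/

theorem ybOf_injective (h : IsSymmetricSet r) : Function.Injective (ybOf r) := by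
  intro x y hxy
  have h1 := congrArg h.cocycle hxy
  rw [cocycle_of, cocycle_of] at h1
  exact Finsupp.single_left_injective one_ne_zero h1

theorem linAct_inj (h : IsSymmetricSet r) (a : YBGroup r) {v w : X →₀ ℤ} :
    h.linAct a v = h.linAct a w ↔ v = w :=
  (h.linAct a).injective.eq_iff

/-- The braiding is known only through its axioms and its values on generators, so this is an
induction on the word u. Since ˣ(uv) = (ˣu)(ᶻv) with z = xᵘ, the induction must also carry the fact
that xᵘ is again a generator, and must run over all x at once. -/
theorem cocycle_lact_braiding_of (h : IsSymmetricSet r) (u : YBGroup r) (x : X) :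
    h.cocycle (lact h.braiding (ybOf r x) u) = h.linAct (ybOf r x) (h.cocycle u) ∧
      ∃ z, ract h.braiding (ybOf r x) u = ybOf r z := by
  have hσ := h.braiding_isSymmetricGroup
  have eσ := h.braiding_extends
  induction u using YBGroup.induction generalizing x with
  | one => exact ⟨by rw [hσ.lact_one, cocycle_one, map_zero], x, hσ.ract_one _⟩
  | of y =>
    exact ⟨by rw [eσ.lact_of, cocycle_of, cocycle_of, linAct_single, ybPerm_of], _, eσ.ract_of x y⟩
  | inv_of y =>
    -- Right non-degeneracy writes the generator as zʸ, so acting on it by y⁻¹ from the right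
    -- returns the generator z.
    obtain ⟨z, rfl⟩ := (h.nondegenerate.right y).2 x
    change h.cocycle (lact h.braiding (ybOf r (ract r z y)) _) =
      h.linAct (ybOf r (ract r z y)) _ ∧ ∃ w, ract h.braiding (ybOf r (ract r z y)) _ = ybOf r w
    have hz : ract h.braiding (ybOf r (ract r z y)) (ybOf r y)⁻¹ = ybOf r z := by
      rw [← eσ.ract_of, ← hσ.ract_mul, mul_inv_cancel, hσ.ract_one]
    refine ⟨?_, z, hz⟩
    -- With x = zʸ, the identity 1 = ˣ(y⁻¹y) = (ˣ(y⁻¹))(ᶻy) determines π(ˣ(y⁻¹)), and (ˣ(y⁻¹))z =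
    -- xy⁻¹ identifies the element acting on e_y.
    have h1 := hσ.lact_mul (ybOf r (ract r z y)) (ybOf r y)⁻¹ (ybOf r y)
    have h2 := hσ.compat (ybOf r (ract r z y)) (ybOf r y)⁻¹
    rw [inv_mul_cancel, hσ.lact_one, hz, eσ.lact_of] at h1
    rw [hz] at h2
    have h3 := congrArg h.cocycle h1
    rw [cocycle_one, cocycle_mul, cocycle_of, ← ybPerm_of h, ← linAct_single, ← linAct_mul, ← h2,
      linAct_mul] at h3
    have h4 := h.cocycle_mul (ybOf r y)⁻¹ (ybOf r y)
    rw [inv_mul_cancel, cocycle_one, cocycle_of] at h4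
    rw [eq_neg_of_add_eq_zero_left h3.symm, eq_neg_of_add_eq_zero_left h4.symm, map_neg]
  | mul u v hu hv =>
    obtain ⟨h1, z, h2⟩ := hu x
    obtain ⟨h3, w, h4⟩ := hv z
    refine ⟨?_, w, by rw [hσ.ract_mul, h2, h4]⟩
    -- (ˣu)z = xu, so the second summand (ˣu)·z·π(v) of π(ˣ(uv)) equals x·u·π(v).
    have h5 := hσ.compat (ybOf r x) u
    rw [h2] at h5
    rw [hσ.lact_mul, cocycle_mul, h1, h2, h3, ← linAct_mul, ← h5, linAct_mul, cocycle_mul, map_add]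

/-- The left action in `(G, r_G)` corresponds, under the canonical cocycle, to the linear action
of `G` on `ℤ^(X)`. -/
theorem cocycle_lact_braiding (h : IsSymmetricSet r) (a u : YBGroup r) :
    h.cocycle (lact h.braiding a u) = h.linAct a (h.cocycle u) := by
  have hσ := h.braiding_isSymmetricGroup
  induction a using YBGroup.induction generalizing u with
  | one => rw [hσ.one_lact, linAct_one]
  | of x => exact (h.cocycle_lact_braiding_of u x).1
  | inv_of x =>
    rw [← h.linAct_inj (ybOf r x), ← (h.cocycle_lact_braiding_of _ x).1, hσ.lact_lact_inv,
      ← linAct_mul, mul_inv_cancel, linAct_one]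
  | mul a b ha hb => rw [hσ.mul_lact, ha, hb, linAct_mul]

theorem cocycle_braceAdd (h : IsSymmetricSet r) (a b : YBGroup r) :
    h.cocycle (braceAdd h.braiding a b) = h.cocycle a + h.cocycle b := by
  rw [braceAdd, cocycle_mul, cocycle_lact_braiding, ← linAct_mul, mul_inv_cancel, linAct_one]

/-! ### Trivial solutions: trivial action and additive cocycle. -/

theorem ybPerm_eq_one (h : IsSymmetricSet r) (ht : IsTrivialSolution r) (a : YBGroup r) :
    h.ybPerm a = 1 := by
  induction a using YBGroup.induction with
  | one => exact map_one _
  | of x => ext y; rw [ybPerm_of, lact, ht]; rfl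
  | inv_of x =>
    rw [map_inv, inv_eq_one]
    ext y
    rw [ybPerm_of, lact, ht]
    rfl
  | mul a b ha hb => rw [map_mul, ha, hb, one_mul]

theorem linAct_eq_self (h : IsSymmetricSet r) (ht : IsTrivialSolution r) (a : YBGroup r)
    (v : X →₀ ℤ) : h.linAct a v = v := by
  rw [← h.linAct_one v, ← linAct_mul, mul_one, linAct, linAct, ybPerm_eq_one h ht, map_one]

theorem cocycle_mul_of_isTrivialSolution (h : IsSymmetricSet r) (ht : IsTrivialSolution r)
    (a b : YBGroup r) : h.cocycle (a * b) = h.cocycle a + h.cocycle b := by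
  rw [cocycle_mul, linAct_eq_self h ht]

theorem braiding_isTrivialSolution (h : IsSymmetricSet r) (ht : IsTrivialSolution r) :
    IsTrivialSolution h.braiding := by
  have hl : ∀ a b, lact h.braiding a b = b := fun a b => h.cocycle_bijective.1 <| by
    rw [cocycle_lact_braiding, linAct_eq_self h ht]
  intro a b
  have h1 := h.braiding_isSymmetricGroup.lact_lact_ract a b
  rw [hl] at h1
  exact Prod.ext (hl a b) h1

/-! ### Freeness and two-sidedness. -/

theorem isFreeAbelian (h : IsSymmetricSet r) (ht : IsTrivialSolution r) :
    YBGroup.IsFreeAbelian r := by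
  let c : Additive (YBGroup r) ≃+ (X →₀ ℤ) :=
    { Additive.toMul.trans (Equiv.ofBijective _ h.cocycle_bijective) with
      map_add' := fun a b => h.cocycle_mul_of_isTrivialSolution ht a.toMul b.toMul }
  refine ⟨(FreeAbelianGroup.equivFinsupp X).trans c.symm, fun x => ?_⟩
  rw [AddEquiv.trans_apply, AddEquiv.symm_apply_eq, FreeAbelianGroup.equivFinsupp_apply,
    FreeAbelianGroup.toFinsupp_of]
  exact (h.cocycle_of x).symm

/-- Only commutativity of G is needed: xy = yx reads e_x + e_{ˣy} = e_y + e_{ʸx}. For x ≠ y, the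
coordinate y is at least 1 on the right, and this forces ˣy = y on the left. -/
theorem isTrivialSolution_of_isFreeAbelian (h : IsSymmetricSet r)
    (hf : YBGroup.IsFreeAbelian r) : IsTrivialSolution r := by
  obtain ⟨e, -⟩ := hf
  have comm : ∀ a b : YBGroup r, a * b = b * a := fun a b => by
    have h1 : e.symm (Additive.ofMul a + Additive.ofMul b) =
        e.symm (Additive.ofMul b + Additive.ofMul a) := by
      rw [map_add, map_add, add_comm]
    exact e.symm.injective h1
  have hne : ∀ x y, x ≠ y → lact r x y = y := by
    intro x y hxy
    have h1 := congrArg h.cocycle (comm (ybOf r x) (ybOf r y))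
    simp only [cocycle_mul, cocycle_of, linAct_single, ybPerm_of] at h1
    by_contra hy
    have h2 := DFunLike.congr_fun h1 y
    rw [Finsupp.add_apply, Finsupp.add_apply, Finsupp.single_eq_of_ne hxy.symm,
      Finsupp.single_eq_of_ne (Ne.symm hy), Finsupp.single_eq_same] at h2
    have h3 := single_one_apply_mem (lact r y x) y
    omega
  refine h.isTrivialSolution_of_lact_eq fun x y => ?_
  by_cases hxy : x = y
  · subst hxy
    -- The diagonal case: if ˣx ≠ x, the off-diagonal case says that x fixes ˣx, so x and ˣx have
    -- the same image under x, against injectivity.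
    by_contra hx
    exact hx ((h.nondegenerate.left x).1 (hne x _ (Ne.symm hx)))
  · exact hne x y hxy

theorem isTwoSided (h : IsSymmetricSet r) (ht : IsTrivialSolution r) :
    h.leftBrace.IsTwoSided := by
  intro a b c
  change braceAdd h.braiding (braceAdd h.braiding a b * c) c = braceAdd h.braiding (a * c) (b * c)
  apply h.cocycle_bijective.1
  simp only [cocycle_braceAdd, cocycle_mul_of_isTrivialSolution h ht]
  abel

/-- Right distributivity for (x + x)y gives 2e_x + e_w + e_y = 2e_x + 2e_{ˣy}, where w is the image
of y under x + x. If ˣy ≠ y, then after cancelling 2e_x the coordinate y is positive on the left and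
0 on the right. -/
theorem isTrivialSolution_of_isTwoSided (h : IsSymmetricSet r) (hB : h.leftBrace.IsTwoSided) :
    IsTrivialSolution r := by
  refine h.isTrivialSolution_of_lact_eq fun x y => ?_
  have h1 : braceAdd h.braiding (braceAdd h.braiding (ybOf r x) (ybOf r x) * ybOf r y) (ybOf r y) =
    braceAdd h.braiding (ybOf r x * ybOf r y) (ybOf r x * ybOf r y) := hB _ _ _
  have h2 := DFunLike.congr_fun (congrArg h.cocycle h1) y
  simp only [cocycle_braceAdd, cocycle_mul, cocycle_of, linAct_single, ybPerm_of,
    Finsupp.add_apply, Finsupp.single_eq_same] at h2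
  by_contra hy
  rw [Finsupp.single_eq_of_ne (a := lact r x y) (Ne.symm hy)] at h2
  have h3 := single_one_apply_mem (h.ybPerm (braceAdd h.braiding (ybOf r x) (ybOf r x)) y) y
  omega

/-! ### Square-freeness. -/

theorem isTrivialSolution_of_isSquareFree_braiding (h : IsSymmetricSet r) (hX : IsSquareFree r)
    (hG : ∀ a, lact h.braiding a a = a) : IsTrivialSolution r := by
  have hs : ∀ z, h.ybPerm (ybOf r z) z = z := fun z => by rw [ybPerm_of, lact, hX]
  refine h.isTrivialSolution_of_lact_eq fun x z => ?_
  -- If ˣz = x, then ˣx = x and injectivity give z = x.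
  by_cases hxy : x = lact r x z
  · have h1 : lact r x x = x := by rw [lact, hX]
    have h2 : x = z := (h.nondegenerate.left x).1 (h1.trans hxy)
    rw [← hxy, h2]
  -- `a = x z z` has cocycle `e_x + 2 e_y` with `y = ˣz ≠ x`, so `ᵃa = a` forces `ᵃy = y`.
  have h1 := congrArg h.cocycle (hG (ybOf r x * (ybOf r z * ybOf r z)))
  rw [cocycle_lact_braiding] at h1
  have hc : h.cocycle (ybOf r x * (ybOf r z * ybOf r z)) =
      Finsupp.single x 1 + Finsupp.single (lact r x z) 2 := by
    simp only [cocycle_mul, cocycle_of, linAct_single, hs, ybPerm_of,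
      ← Finsupp.single_add]
    rfl
  rw [hc, map_add, linAct_single, linAct_single] at h1
  have h2 : h.ybPerm (ybOf r x * (ybOf r z * ybOf r z)) (lact r x z) = lact r x z := by
    -- The unequal coefficients matter: with e_x + e_y, a could swap x and y. Here the coordinate y
    -- is 2 on the right, while on the left only the image of e_x could contribute, and at most 1.
    by_contra hne
    have h3 := DFunLike.congr_fun h1 (lact r x z)
    rw [Finsupp.add_apply, Finsupp.add_apply, Finsupp.single_eq_of_ne (Ne.symm hne),
      Finsupp.single_eq_of_ne (Ne.symm hxy), Finsupp.single_eq_same] at h3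
    have h4 := single_one_apply_mem (h.ybPerm (ybOf r x * (ybOf r z * ybOf r z)) x) (lact r x z)
    omega
  rw [map_mul, map_mul, Equiv.Perm.mul_apply, Equiv.Perm.mul_apply, ybPerm_of h x] at h2
  have h3 := (h.nondegenerate.left x).1 h2
  -- Cancelling x in ᵃy = y = ˣz leaves z·(z·y) = z. As z also fixes itself, applying z twice shows
  -- y = z.
  apply (h.ybPerm (ybOf r z)).injective
  apply (h.ybPerm (ybOf r z)).injective
  rw [h3, hs, hs]

/-- X embeds in G because π sends generators to distinct basis vectors, so `r` is a restriction of
`h.braiding`. -/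
theorem isSquareFree_of_braiding (h : IsSymmetricSet r) (hG : IsSquareFree h.braiding) :
    IsSquareFree r := by
  intro x
  have h1 := congrFun h.braiding_extends (x, x)
  simp only [Function.comp_apply, Prod.map_apply, hG (ybOf r x)] at h1
  exact (h.ybOf_injective.prodMap h.ybOf_injective (a₁ := (x, x)) h1).symm

end IsSymmetricSet

end YangBaxter

theorem mainTheorem6 {X : Type*} (r : X × X → X × X) (h : YangBaxter.IsSymmetricSet r) :
    List.TFAE [
      h.leftBrace.IsTwoSided,
      YangBaxter.IsSquareFree h.braiding,
      YangBaxter.IsSquareFree r ∧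
        ∀ x y : YangBaxter.YBGroup r, YangBaxter.lact h.braiding (x * y) (x * y) = x * y,
      YangBaxter.YBGroup.IsFreeAbelian r,
      YangBaxter.IsTrivialSolution r] ∧
    (YangBaxter.YBGroup.IsFreeAbelian r → YangBaxter.IsTrivialSolution h.braiding) := by
  refine ⟨?_, fun hf => h.braiding_isTrivialSolution (h.isTrivialSolution_of_isFreeAbelian hf)⟩
  tfae_have 1 → 5 := h.isTrivialSolution_of_isTwoSided
  tfae_have 5 → 1 := h.isTwoSided
  tfae_have 5 → 2 := fun ht a => h.braiding_isTrivialSolution ht a a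
  tfae_have 2 → 3 := fun hG =>
    ⟨h.isSquareFree_of_braiding hG, fun x y => congrArg Prod.fst (hG (x * y))⟩
  -- Taking the second factor to be 1 makes the condition on products a condition on every element.
  tfae_have 3 → 5 := fun hX => h.isTrivialSolution_of_isSquareFree_braiding hX.1 fun a => by
    simpa only [mul_one] using hX.2 a 1
  tfae_have 4 → 5 := h.isTrivialSolution_of_isFreeAbelian
  tfae_have 5 → 4 := h.isFreeAbelian
  tfae_finish
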